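/- **Proposition 5.3 (Bessel kernel).** Let $\alpha>1$ and $T>0$, and let $f$ be the Bessel kernel on $\mathbb{R}^3$, $$f(x)=\int_0^\infty w^{\frac{\alpha-5}{2}}e^{-w}e^{-\frac{|x|^2}{4w}}\,dw ,$$ where the integral converges for every $x\neq 0$. Let $\sigma$ be the uniform surface measure on the unit sphere $S^2\subset\mathbb{R}^3$. Then: (H1) $\displaystyle\int_{|x|\le 1}\frac{f(x)}{|x|}\,dx<\infty$. (Space increments) For every $0<\gamma<\min(\alpha-1,1)$ and every $0<\gamma'<\min(\alpha-1,2)$ there is a constant $C<\infty$ such that, for all $w\in\mathbb{R}^3$, $$\int_{|z|\le 2T}\frac{|f(z+w)-f(z)|}{|z|}\,dz\le C|w|^{\gamma} \quad\text{and}\quad \int_{|z|\le 2T}\frac{|f(z+w)+f(z-w)-2f(z)|}{|z|}\,dz\le C|w|^{\gamma'} .$$ (Condition (1)) For every $0<\nu<\min(\alpha-1,1)$ there is a constant $C<\infty$ such that $\displaystyle\int_{|z|\le h}\frac{f(z)}{|z|}\,dz\le Ch^{\nu}$ for all $0<h\le 2T$. (Time increments) For every $0<\rho_1<\min(\alpha-1,1)$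 and every $0<\rho_2<\min(\alpha-1,2)$ there is a constant $C<\infty$ such that, for all $0<h\le 1$, $$\int_0^T\!\int_{S^2}\!\int_{S^2}\bigl|f\bigl(s(\xi+\eta)+h(\xi+\eta)\bigr)-f\bigl(s(\xi+\eta)+h\eta\bigr)\bigr|\,s\,\sigma(d\xi)\,\sigma(d\eta)\,ds\le C h^{\rho_1}$$ and $$\int_0^T\!\int_{S^2}\!\int_{S^2}\bigl|f\bigl(s(\xi+\eta)+h(\xi+\eta)\bigr)-f\bigl(s(\xi+\eta)+h\xi\bigr)-f\bigl(s(\xi+\eta)+h\eta\bigr)+f\bigl(s(\xi+\eta)\bigr)\bigr|\,s^2\,\sigma(d\xi)\,\sigma(d\eta)\,ds\le C h^{\rho_2}.$$ The constants may depend on $\alpha$, $T$ and the exponents, but not on $w$ or $h$. -/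

import Mathlib

open MeasureTheory Set

noncomputable section

namespace StochWave

/-- Three-dimensional Euclidean space. -/
abbrev R3 : Type := EuclideanSpace ℝ (Fin 3)

/-- The unit sphere `S²`. -/
abbrev S2 : Type := Metric.sphere (0 : R3) 1

/-- The uniform surface measure on `S²`, of total mass `4π`. -/
def sigma : Measure S2 := (volume : Measure R3).toSphere

/-- The integrand `w ↦ w^{(α-5)/2} e^{-w} e^{-|x|²/(4w)}` of the Bessel kernel. -/
def besselIntegrand (α : ℝ) (x : R3) (w : ℝ) : ℝ :=
  w ^ ((α - 5) / 2) * Real.exp (-w) * Real.exp (-(‖x‖ ^ 2 / (4 * w)))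

/-- The Bessel kernel. The integral converges for every `x ≠ 0`; at the single point `x = 0`
it diverges when `α ≤ 3`, and Lean then assigns the value `0` there. No condition below
depends on the value at that point. -/
def besselKernel (α : ℝ) (x : R3) : ℝ :=
  ∫ w in Ioi (0 : ℝ), besselIntegrand α x w

/-- `∫_{|x| ≤ 1} f(x)/|x| dx < ∞`. -/
def CondH1 (f : R3 → ℝ) : Prop :=
  IntegrableOn (fun x => f x / ‖x‖) (Metric.closedBall 0 1)

/-- First-order spatial increments: for some `C` and all `w ∈ ℝ³`,
`∫_{|z| ≤ 2T} |f(z+w) - f(z)|/|z| dz ≤ C |w|^γ`. -/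
def SpaceCond1 (f : R3 → ℝ) (T γ : ℝ) : Prop :=
  ∃ C : ℝ, ∀ w : R3,
    ∫⁻ z in Metric.closedBall (0 : R3) (2 * T),
        ENNReal.ofReal (|f (z + w) - f z| / ‖z‖)
      ≤ ENNReal.ofReal (C * ‖w‖ ^ γ)

/-- Second-order spatial increments: for some `C` and all `w ∈ ℝ³`,
`∫_{|z| ≤ 2T} |f(z+w) + f(z-w) - 2f(z)|/|z| dz ≤ C |w|^{γ'}`. -/
def SpaceCond2 (f : R3 → ℝ) (T γ' : ℝ) : Prop :=
  ∃ C : ℝ, ∀ w : R3,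
    ∫⁻ z in Metric.closedBall (0 : R3) (2 * T),
        ENNReal.ofReal (|f (z + w) + f (z - w) - 2 * f z| / ‖z‖)
      ≤ ENNReal.ofReal (C * ‖w‖ ^ γ')

/-- For some `C` and all `0 < h ≤ 2T`, `∫_{|z| ≤ h} f(z)/|z| dz ≤ C h^ν`. -/
def SmallBallCond (f : R3 → ℝ) (T ν : ℝ) : Prop :=
  ∃ C : ℝ, ∀ h : ℝ, 0 < h → h ≤ 2 * T →
    IntegrableOn (fun z => f z / ‖z‖) (Metric.closedBall 0 h) ∧
    ∫ z in Metric.closedBall (0 : R3) h, f z / ‖z‖ ≤ C * h ^ ν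

/-- First time condition: for some `C` and all `0 < h ≤ 1`,
`∫₀ᵀ ∫_{S²} ∫_{S²} |f(s(ξ+η) + h(ξ+η)) - f(s(ξ+η) + hη)| s σ(dξ) σ(dη) ds ≤ C h^{ρ₁}`. -/
def TimeCond1 (f : R3 → ℝ) (T ρ₁ : ℝ) : Prop :=
  ∃ C : ℝ, ∀ h : ℝ, 0 < h → h ≤ 1 →
    ∫⁻ s in Ioc (0 : ℝ) T, ∫⁻ η : S2, ∫⁻ ξ : S2,
        ENNReal.ofReal
          (|f (s • ((ξ : R3) + (η : R3)) + h • ((ξ : R3) + (η : R3)))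
            - f (s • ((ξ : R3) + (η : R3)) + h • (η : R3))| * s) ∂sigma ∂sigma
      ≤ ENNReal.ofReal (C * h ^ ρ₁)

/-- Second time condition: for some `C` and all `0 < h ≤ 1`,
`∫₀ᵀ ∫_{S²} ∫_{S²} |f(s(ξ+η) + h(ξ+η)) - f(s(ξ+η) + hξ) - f(s(ξ+η) + hη) + f(s(ξ+η))|
  s² σ(dξ) σ(dη) ds ≤ C h^{ρ₂}`. -/
def TimeCond2 (f : R3 → ℝ) (T ρ₂ : ℝ) : Prop :=
  ∃ C : ℝ, ∀ h : ℝ, 0 < h → h ≤ 1 →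
    ∫⁻ s in Ioc (0 : ℝ) T, ∫⁻ η : S2, ∫⁻ ξ : S2,
        ENNReal.ofReal
          (|f (s • ((ξ : R3) + (η : R3)) + h • ((ξ : R3) + (η : R3)))
            - f (s • ((ξ : R3) + (η : R3)) + h • (ξ : R3))
            - f (s • ((ξ : R3) + (η : R3)) + h • (η : R3))
            + f (s • ((ξ : R3) + (η : R3)))| * s ^ 2) ∂sigma ∂sigma
      ≤ ENNReal.ofReal (C * h ^ ρ₂)

end StochWave

end

noncomputable section

namespace StochWave

/-! ### Exponential increments -/

/-! The kernel is a mixture of the Gaussians `gauss t`, that is e^{-|x|²/(4t)}, with weight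
t^{(α-5)/2} e^{-t}. By the triangle inequality and Tonelli (`lintegral_le_besselMoment`), each
estimate reduces to one Gaussian: if that contribution is at most A t^p, the total is at most A ∫
t^{p+(α-5)/2} e^{-t} dt, finite when p + (α-5)/2 > -1.

For a step of length H put κ = H²/t. If κ ≤ 1, a first difference of Gaussians is O(√κ) and a second
difference O(κ), because the linear terms of the exponent cancel; in both cases a wider Gaussian
survives (`exp_increment_le`, `exp_second_increment_le`). If κ > 1 the trivial bound suffices. Both
regimes are covered by a factor κ^{ρ/2}, with ρ ≤ 1 or ρ ≤ 2 respectively.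

In space, ∫ e^{-|z|²/b}/|z| dz is proportional to b, so one Gaussian contributes t κ^{γ/2} = |w|^γ
t^{1-γ/2}, and the moment is finite exactly for γ < α-1. Small balls give min(r², t) and the same
exponents.

In time, every exponent depends on ξ, η only through N = |ξ+η|². The bound ∫ e^{-cN} σ(dξ) ≤ C
c^{-θ} with 0 ≤ θ ≤ 1 (`exists_lintegral_sphere_exp_le`), at c = s²/(16t), produces s^{j-2θ}
t^{θ-ρ/2}, where j is the power of s in the condition. It remains to choose θ making both the
s-integral and the moment finite. -/

lemma abs_exp_neg_sub_exp_neg_le {m a b : ℝ} (ha : m ≤ a) (hb : m ≤ b) :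
    |Real.exp (-a) - Real.exp (-b)| ≤ Real.exp (-m) * |a - b| := by
  wlog hab : a ≤ b generalizing a b
  · rw [abs_sub_comm, abs_sub_comm a b]
    exact this hb ha (le_of_not_ge hab)
  have h1 : Real.exp (-b) ≤ Real.exp (-a) := Real.exp_le_exp.2 (by linarith)
  rw [abs_of_nonneg (by linarith), abs_of_nonpos (by linarith)]
  have h2 : Real.exp (-b) = Real.exp (-a) * Real.exp (-(b - a)) := by
    rw [← Real.exp_add]; congr 1; ring
  have h3 : 1 - (b - a) ≤ Real.exp (-(b - a)) := by
    have := Real.add_one_le_exp (-(b - a)); linarith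
  have h4 : Real.exp (-a) ≤ Real.exp (-m) := Real.exp_le_exp.2 (by linarith)
  calc Real.exp (-a) - Real.exp (-b) = Real.exp (-a) * (1 - Real.exp (-(b - a))) := by
        rw [h2]; ring
    _ ≤ Real.exp (-a) * (b - a) := by
        apply mul_le_mul_of_nonneg_left _ (Real.exp_pos _).le; linarith
    _ ≤ Real.exp (-m) * (b - a) := mul_le_mul_of_nonneg_right h4 (by linarith)
    _ = _ := by ring

/-- Completing the square, e^{-a} - 2e^{-b} + e^{-d} = (e^{-a/2} - e^{-d/2})² + 2(e^{-(a+d)/2} -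
e^{-b}). Both parts are then first differences, the first of them squared, so no Taylor expansion is
needed. -/
lemma abs_exp_neg_second_difference_le {m a b d : ℝ} (ha : m ≤ a) (hb : m ≤ b) (hd : m ≤ d) :
    |Real.exp (-a) - 2 * Real.exp (-b) + Real.exp (-d)| ≤
      Real.exp (-m) * ((a - d) ^ 2 / 4 + |a + d - 2 * b|) := by
  have key : Real.exp (-a) - 2 * Real.exp (-b) + Real.exp (-d) =
      (Real.exp (-(a / 2)) - Real.exp (-(d / 2))) ^ 2 +
        2 * (Real.exp (-((a + d) / 2)) - Real.exp (-b)) := by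
    have e1 : Real.exp (-a) = Real.exp (-(a / 2)) ^ 2 := by
      rw [← Real.exp_nat_mul]; congr 1; push_cast; ring
    have e2 : Real.exp (-d) = Real.exp (-(d / 2)) ^ 2 := by
      rw [← Real.exp_nat_mul]; congr 1; push_cast; ring
    have e3 : Real.exp (-((a + d) / 2)) = Real.exp (-(a / 2)) * Real.exp (-(d / 2)) := by
      rw [← Real.exp_add]; congr 1; ring
    rw [e1, e2, e3]; ring
  have h1 := abs_exp_neg_sub_exp_neg_le (m := m / 2) (a := a / 2) (b := d / 2)
    (by linarith) (by linarith)
  have h2 := abs_exp_neg_sub_exp_neg_le (m := m) (a := (a + d) / 2) (b := b)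
    (by linarith) hb
  have h3 : (Real.exp (-(a / 2)) - Real.exp (-(d / 2))) ^ 2 ≤
      Real.exp (-m) * ((a - d) ^ 2 / 4) := by
    rw [← sq_abs]
    calc _ ≤ (Real.exp (-(m / 2)) * |a / 2 - d / 2|) ^ 2 :=
          pow_le_pow_left₀ (abs_nonneg _) h1 2
      _ = _ := by
          rw [mul_pow, sq_abs, ← Real.exp_nat_mul]
          congr 1
          · congr 1; push_cast; ring
          · ring
  have h4 : |(a + d) / 2 - b| = |a + d - 2 * b| / 2 := by
    rw [← abs_of_pos (show (0 : ℝ) < 2 by norm_num), ← abs_div]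
    congr 1
    rw [abs_of_pos (show (0 : ℝ) < 2 by norm_num)]; ring
  rw [key]
  refine (abs_add_le _ _).trans ?_
  rw [abs_of_nonneg (sq_nonneg _), abs_mul, abs_of_pos (show (0 : ℝ) < 2 by norm_num)]
  rw [h4] at h2
  linarith

lemma exp_quarter_le : Real.exp (1 / 4) ≤ 3 / 2 := by
  have h : Real.exp (1 / 4) ^ 4 ≤ (3 / 2 : ℝ) ^ 4 := by
    rw [← Real.exp_nat_mul]
    have := Real.exp_one_lt_d9
    norm_num
    linarith
  exact le_of_pow_le_pow_left₀ (by norm_num) (by norm_num) h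

/-- Half of the decay e^{-D/2} is spent on absorbing the polynomial factor 1 + D/4 ≤ e^{D/4}. -/
lemma exp_shift_le {D c : ℝ} (hc : 0 ≤ c) :
    Real.exp (-(D / 2 - 1 / 4)) * (c * (1 + D / 4)) ≤ (3 / 2 * c) * Real.exp (-(D / 4)) := by
  have h1 : 1 + D / 4 ≤ Real.exp (D / 4) := by linarith [Real.add_one_le_exp (D / 4)]
  have h2 : Real.exp (-(D / 2 - 1 / 4)) * Real.exp (D / 4) =
      Real.exp (1 / 4) * Real.exp (-(D / 4)) := by
    rw [← Real.exp_add, ← Real.exp_add]; congr 1; ring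
  calc _ ≤ Real.exp (-(D / 2 - 1 / 4)) * (c * Real.exp (D / 4)) := by gcongr
    _ = c * (Real.exp (1 / 4) * Real.exp (-(D / 4))) := by rw [← h2]; ring
    _ ≤ c * (3 / 2 * Real.exp (-(D / 4))) := by gcongr; exact exp_quarter_le
    _ = _ := by ring

/-- Here D is the exponent at the base point, κ the squared step over t, and p bounds the cross
term. Since p ≤ √κ √D and √D ≤ 1 + D/4, the exponents differ by at most 2√κ (1 + D/4). The constant
12 is generous here; it is the one needed for second differences. -/
lemma exp_increment_le {D κ p a b ρ : ℝ} (hD : 0 ≤ D) (hκ : 0 < κ) (hκ1 : κ ≤ 1)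
    (hp : p ^ 2 ≤ κ * D) (ha : D / 2 - 1 / 4 ≤ a) (hb : D / 2 - 1 / 4 ≤ b)
    (hab : |a - b| ≤ p + κ) (hρ1 : ρ ≤ 1) :
    |Real.exp (-a) - Real.exp (-b)| ≤ 12 * κ ^ (ρ / 2) * Real.exp (-(D / 4)) := by
  have hs : √κ ≤ κ ^ (ρ / 2) := by
    rw [Real.sqrt_eq_rpow]
    exact Real.rpow_le_rpow_of_exponent_ge hκ hκ1 (by linarith)
  have hs1 : κ ≤ √κ := by
    have h := Real.sq_sqrt hκ.le
    have h1 : √κ ≤ 1 := Real.sqrt_le_one.2 hκ1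
    nlinarith [Real.sqrt_nonneg κ]
  have hp' : p ≤ √κ * √D := by
    rw [← Real.sqrt_mul hκ.le]
    exact Real.le_sqrt_of_sq_le hp
  have hD' : √D ≤ 1 + D / 4 := by
    have h := Real.sq_sqrt hD
    nlinarith [sq_nonneg (√D / 2 - 1)]
  have h1 : |a - b| ≤ (2 * √κ) * (1 + D / 4) := by
    have : √κ * √D ≤ √κ * (1 + D / 4) := by gcongr
    nlinarith [Real.sqrt_nonneg κ]
  calc _ ≤ Real.exp (-(D / 2 - 1 / 4)) * |a - b| := abs_exp_neg_sub_exp_neg_le ha hb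
    _ ≤ Real.exp (-(D / 2 - 1 / 4)) * ((2 * √κ) * (1 + D / 4)) := by gcongr
    _ ≤ 3 / 2 * (2 * √κ) * Real.exp (-(D / 4)) := exp_shift_le (by positivity)
    _ ≤ 12 * κ ^ (ρ / 2) * Real.exp (-(D / 4)) := by
        refine mul_le_mul_of_nonneg_right ?_ (Real.exp_pos _).le
        nlinarith [Real.sqrt_nonneg κ]

lemma exp_second_increment_le {D κ a b d ρ : ℝ} (hκ : 0 < κ) (hκ1 : κ ≤ 1)
    (ha : D / 2 - 1 / 4 ≤ a) (hb : D / 2 - 1 / 4 ≤ b) (hd : D / 2 - 1 / 4 ≤ d)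
    (h : (a - d) ^ 2 / 4 + |a + d - 2 * b| ≤ κ * (2 * D + 1)) (hρ2 : ρ ≤ 2) :
    |Real.exp (-a) - 2 * Real.exp (-b) + Real.exp (-d)| ≤
      12 * κ ^ (ρ / 2) * Real.exp (-(D / 4)) := by
  have hs : κ ≤ κ ^ (ρ / 2) := by
    nth_rewrite 1 [← Real.rpow_one κ]
    exact Real.rpow_le_rpow_of_exponent_ge hκ hκ1 (by linarith)
  calc _ ≤ Real.exp (-(D / 2 - 1 / 4)) * ((a - d) ^ 2 / 4 + |a + d - 2 * b|) :=
        abs_exp_neg_second_difference_le ha hb hd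
    _ ≤ Real.exp (-(D / 2 - 1 / 4)) * ((8 * κ) * (1 + D / 4)) := by
        gcongr
        nlinarith
    _ ≤ 3 / 2 * (8 * κ) * Real.exp (-(D / 4)) := exp_shift_le (by positivity)
    _ ≤ 12 * κ ^ (ρ / 2) * Real.exp (-(D / 4)) := by
        refine mul_le_mul_of_nonneg_right ?_ (Real.exp_pos _).le
        linarith


/-! ### Gaussian integrals on space and on the sphere -/

/-- In polar coordinates the integrand becomes r e^{-r²/b}, with integral b/2; the remaining factor
3 vol(B) is the area of the sphere. -/
lemma exists_lintegral_exp_neg_div_norm_le : ∃ C : ℝ, 0 ≤ C ∧ ∀ b : ℝ, 0 < b →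
    ∫⁻ z : R3, ENNReal.ofReal (Real.exp (-(‖z‖ ^ 2 / b)) / ‖z‖) ≤ ENNReal.ofReal (C * b) := by
  refine ⟨3 * (volume : Measure R3).real (Metric.ball 0 1) / 2, by positivity, fun b hb => ?_⟩
  have hrw : ∀ y ∈ Ioi (0 : ℝ), y ^ (Module.finrank ℝ R3 - 1) • (Real.exp (-(y ^ 2 / b)) / y) =
      y ^ (1 : ℝ) * Real.exp (-b⁻¹ * y ^ (2 : ℝ)) := by
    intro y hy
    have hy' : y ≠ 0 := (mem_Ioi.1 hy).ne'
    have hd : Module.finrank ℝ R3 - 1 = 2 := by simp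
    rw [hd, smul_eq_mul, Real.rpow_one, Real.rpow_two]
    have : -b⁻¹ * y ^ 2 = -(y ^ 2 / b) := by field_simp
    rw [this]
    field_simp
  have hint : Integrable (fun z : R3 => Real.exp (-(‖z‖ ^ 2 / b)) / ‖z‖) := by
    refine (integrable_fun_norm_addHaar (volume : Measure R3)
      (f := fun y => Real.exp (-(y ^ 2 / b)) / y)).2 ?_
    refine IntegrableOn.congr_fun ?_ (fun y hy => (hrw y hy).symm) measurableSet_Ioi
    have := integrableOn_rpow_mul_exp_neg_mul_sq (inv_pos.2 hb) (s := 1) (by norm_num)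
    simpa using this
  rw [← ofReal_integral_eq_lintegral_ofReal hint
    (Filter.Eventually.of_forall fun z => by positivity)]
  apply ENNReal.ofReal_le_ofReal
  rw [integral_fun_norm_addHaar (volume : Measure R3) (fun y => Real.exp (-(y ^ 2 / b)) / y),
    setIntegral_congr_fun measurableSet_Ioi hrw,
    integral_rpow_mul_exp_neg_mul_rpow (by norm_num) (by norm_num) (inv_pos.2 hb)]
  norm_num
  rw [Real.rpow_neg_one, inv_inv]
  apply le_of_eq
  ring

lemma lintegral_polar (F : R3 → ENNReal) (hF : Measurable F) :
    ∫⁻ x : R3, F x = ∫⁻ ξ : S2, ∫⁻ r : Ioi (0 : ℝ), F (r.1 • (ξ : R3))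
      ∂(Measure.volumeIoiPow 2) ∂sigma := by
  have hmp := (volume : Measure R3).measurePreserving_homeomorphUnitSphereProd
  have hd : Module.finrank ℝ R3 - 1 = 2 := by simp
  rw [hd] at hmp
  rw [← lintegral_prod (μ := sigma) (ν := Measure.volumeIoiPow 2)
    (fun p : S2 × Ioi (0 : ℝ) => F (p.2.1 • (p.1 : R3))) (by fun_prop)]
  have h1 := hmp.lintegral_comp_emb (Homeomorph.measurableEmbedding _)
    (fun p : S2 × Ioi (0 : ℝ) => F (p.2.1 • (p.1 : R3)))
  unfold sigma
  rw [← h1]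
  simp only [← homeomorphUnitSphereProd_symm_apply_coe, Homeomorph.symm_apply_apply]
  rw [lintegral_subtype_comap (measurableSet_singleton (0 : R3)).compl F,
    restrict_compl_singleton]

lemma norm_S2 (ξ : S2) : ‖(ξ : R3)‖ = 1 := mem_sphere_zero_iff_norm.1 ξ.2

lemma norm_smul_add_sq (r : ℝ) (ξ η : S2) :
    ‖r • (ξ : R3) + (η : R3)‖ ^ 2 = (r - 1) ^ 2 + r * ‖(ξ : R3) + (η : R3)‖ ^ 2 := by
  rw [norm_add_sq_real, norm_add_sq_real, norm_smul, inner_smul_left, norm_S2, norm_S2,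
    mul_one, Real.norm_eq_abs, sq_abs]
  simp
  ring

lemma volumeIoiPow_shell_ge {δ : ℝ} (hδ : 0 < δ) :
    ENNReal.ofReal δ ≤ Measure.volumeIoiPow 2 {r : Ioi (0 : ℝ) | 1 ≤ r.1 ∧ r.1 < 1 + δ} := by
  have hset : {r : Ioi (0 : ℝ) | 1 ≤ r.1 ∧ r.1 < 1 + δ} =
      Iio (⟨1 + δ, by simp; linarith⟩ : Ioi (0 : ℝ)) \ Iio (⟨1, by simp⟩ : Ioi (0 : ℝ)) := by
    ext r
    simp only [mem_ofPred_eq, mem_sdiff, mem_Iio, not_lt, ← Subtype.coe_lt_coe]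
    tauto
  have hsub : Iio (⟨1, by simp⟩ : Ioi (0 : ℝ)) ⊆
      Iio (⟨1 + δ, by simp; linarith⟩ : Ioi (0 : ℝ)) := by
    apply Iio_subset_Iio
    rw [← Subtype.coe_le_coe]
    simp; linarith
  rw [hset, measure_sdiff hsub measurableSet_Iio.nullMeasurableSet
    (by rw [Measure.volumeIoiPow_apply_Iio]; exact ENNReal.ofReal_ne_top),
    Measure.volumeIoiPow_apply_Iio, Measure.volumeIoiPow_apply_Iio,
    ← ENNReal.ofReal_sub _ (by positivity)]
  apply ENNReal.ofReal_le_ofReal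
  norm_num
  nlinarith [sq_nonneg δ, pow_pos hδ 3]

/-- The sphere is thickened and compared with a Gaussian on ℝ³ centred at -η, of total mass
(π/c)^{3/2}. On the shell 1 ≤ r < 1 + δ with δ = c^{-1/2}, the identity |rξ+η|² = (r-1)² + r|ξ+η|²
keeps this Gaussian above e^{-1} e^{-2c|ξ+η|²}. The shell has radial mass at least δ, and dividing
by δ leaves 1/c. -/
lemma lintegral_sphere_exp_le_of_one_le {c : ℝ} (hc : 1 ≤ c) (η : S2) :
    ∫⁻ ξ : S2, ENNReal.ofReal (Real.exp (-(2 * c * ‖(ξ : R3) + (η : R3)‖ ^ 2))) ∂sigma ≤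
      ENNReal.ofReal (Real.exp 1 * Real.pi ^ (3 / 2 : ℝ) / c) := by
  have hc0 : 0 < c := by linarith
  set F : R3 → ENNReal := fun x => ENNReal.ofReal (Real.exp (-c * ‖x + (η : R3)‖ ^ 2)) with hF
  have hint : Integrable (fun v : R3 => Real.exp (-c * ‖v‖ ^ 2)) := by
    -- A divergent integral has the default value 0, contradicting the positive value of the
    -- Gaussian integral.
    by_contra h
    have := GaussianFourier.integral_rexp_neg_mul_sq_norm (V := R3) hc0
    rw [integral_undef h] at this
    have h2 : 0 < (Real.pi / c) ^ ((Module.finrank ℝ R3 : ℝ) / 2) := by positivity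
    linarith
  have htot : ∫⁻ x, F x = ENNReal.ofReal ((Real.pi / c) ^ (3 / 2 : ℝ)) := by
    rw [hF, lintegral_add_right_eq_self
      (fun x : R3 => ENNReal.ofReal (Real.exp (-c * ‖x‖ ^ 2))) (η : R3),
      ← ofReal_integral_eq_lintegral_ofReal hint
        (Filter.Eventually.of_forall fun z => (Real.exp_pos _).le),
      GaussianFourier.integral_rexp_neg_mul_sq_norm hc0]
    simp
  have hFm : Measurable F := by fun_prop
  rw [lintegral_polar F hFm] at htot
  set δ : ℝ := 1 / √c with hδ
  have hδ0 : 0 < δ := by positivity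
  have hδ1 : δ ≤ 1 := by
    rw [hδ, div_le_one (by positivity)]
    exact Real.one_le_sqrt.2 hc
  have hδc : c * δ ^ 2 = 1 := by
    rw [hδ, div_pow, Real.sq_sqrt hc0.le]; field_simp
  have hlow : ∀ ξ : S2, ENNReal.ofReal (Real.exp (-1) * δ) *
      ENNReal.ofReal (Real.exp (-(2 * c * ‖(ξ : R3) + (η : R3)‖ ^ 2))) ≤
      ∫⁻ r : Ioi (0 : ℝ), F (r.1 • (ξ : R3)) ∂(Measure.volumeIoiPow 2) := by
    intro ξ
    set S := {r : Ioi (0 : ℝ) | 1 ≤ r.1 ∧ r.1 < 1 + δ}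
    have hS : MeasurableSet S := by
      apply MeasurableSet.inter
      · exact measurableSet_le measurable_const measurable_subtype_coe
      · exact measurableSet_lt measurable_subtype_coe measurable_const
    calc _ = ENNReal.ofReal (Real.exp (-1) *
            Real.exp (-(2 * c * ‖(ξ : R3) + (η : R3)‖ ^ 2))) * ENNReal.ofReal δ := by
          rw [ENNReal.ofReal_mul (Real.exp_pos _).le, ENNReal.ofReal_mul (Real.exp_pos _).le]
          ring
      _ ≤ ENNReal.ofReal (Real.exp (-1) *
            Real.exp (-(2 * c * ‖(ξ : R3) + (η : R3)‖ ^ 2))) * Measure.volumeIoiPow 2 S := by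
          gcongr
          exact volumeIoiPow_shell_ge hδ0
      _ ≤ ∫⁻ r in S, F (r.1 • (ξ : R3)) ∂(Measure.volumeIoiPow 2) := by
          rw [← setLIntegral_const]
          refine setLIntegral_mono' hS fun r hr => ?_
          apply ENNReal.ofReal_le_ofReal
          rw [← Real.exp_add, norm_smul_add_sq]
          apply Real.exp_le_exp.2
          obtain ⟨h1, h2⟩ := hr
          have h3 : (r.1 - 1) ^ 2 ≤ δ ^ 2 := by
            apply pow_le_pow_left₀ <;> linarith
          have h4 : r.1 * ‖(ξ : R3) + (η : R3)‖ ^ 2 ≤ 2 * ‖(ξ : R3) + (η : R3)‖ ^ 2 := by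
            gcongr; linarith
          nlinarith
      _ ≤ _ := setLIntegral_le_lintegral _ _
  have hmul : ENNReal.ofReal (Real.exp (-1) * δ) *
      ∫⁻ ξ : S2, ENNReal.ofReal (Real.exp (-(2 * c * ‖(ξ : R3) + (η : R3)‖ ^ 2))) ∂sigma ≤
      ENNReal.ofReal ((Real.pi / c) ^ (3 / 2 : ℝ)) := by
    rw [← htot, ← lintegral_const_mul' _ _ ENNReal.ofReal_ne_top]
    exact lintegral_mono hlow
  have hk : 0 < Real.exp (-1) * δ := by positivity
  rw [mul_comm, ← ENNReal.le_div_iff_mul_le (Or.inl (by simpa using hk))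
    (Or.inl ENNReal.ofReal_ne_top), ← ENNReal.ofReal_div_of_pos hk] at hmul
  refine hmul.trans (ENNReal.ofReal_le_ofReal (le_of_eq ?_))
  have e1 : c ^ (3 / 2 : ℝ) = c * √c := by
    rw [Real.sqrt_eq_rpow, show (3 / 2 : ℝ) = 1 + 1 / 2 by norm_num, Real.rpow_add hc0,
      Real.rpow_one]
  rw [Real.div_rpow Real.pi_pos.le hc0.le, e1, hδ, Real.exp_neg]
  have : √c ≠ 0 := by positivity
  field_simp

instance : IsFiniteMeasure sigma := by unfold sigma; infer_instance

/-- For c ≥ 2 the decay 1/c is stronger than c^{-θ}; for c < 2 the total mass of σ suffices, as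
c^{-θ} ≥ 1/2. The freedom in θ is needed when the factor s is too weak to compensate s^{-2}. -/
lemma exists_lintegral_sphere_exp_le : ∃ C : ℝ, 0 ≤ C ∧ ∀ θ : ℝ, 0 ≤ θ → θ ≤ 1 →
    ∀ c : ℝ, 0 < c → ∀ η : S2,
    ∫⁻ ξ : S2, ENNReal.ofReal (Real.exp (-(c * ‖(ξ : R3) + (η : R3)‖ ^ 2))) ∂sigma ≤
      ENNReal.ofReal (C * c ^ (-θ)) := by
  set M := sigma.real univ
  set L := 2 * (Real.exp 1 * Real.pi ^ (3 / 2 : ℝ))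
  have hL : 0 ≤ L := by positivity
  have hM : 0 ≤ M := measureReal_nonneg
  refine ⟨2 * M + L, by positivity, fun θ h0 h1 c hc η => ?_⟩
  rcases le_or_gt 2 c with h | h
  · have := lintegral_sphere_exp_le_of_one_le (c := c / 2) (by linarith) η
    rw [show 2 * (c / 2) = c by ring] at this
    refine this.trans (ENNReal.ofReal_le_ofReal ?_)
    have e : c⁻¹ ≤ c ^ (-θ) := by
      rw [← Real.rpow_neg_one]
      exact Real.rpow_le_rpow_of_exponent_le (by linarith) (by linarith)
    calc _ = L * c⁻¹ := by simp only [L]; field_simp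
      _ ≤ (2 * M + L) * c ^ (-θ) := by gcongr; linarith
  · have hb : ∫⁻ ξ : S2, ENNReal.ofReal (Real.exp (-(c * ‖(ξ : R3) + (η : R3)‖ ^ 2))) ∂sigma ≤
        ENNReal.ofReal M := by
      rw [ofReal_measureReal, ← lintegral_one]
      refine lintegral_mono fun ξ => ?_
      rw [← ENNReal.ofReal_one]
      apply ENNReal.ofReal_le_ofReal
      apply Real.exp_le_one_iff.2
      have : 0 ≤ c * ‖(ξ : R3) + (η : R3)‖ ^ 2 := by positivity
      linarith
    refine hb.trans (ENNReal.ofReal_le_ofReal ?_)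
    have e : (1 / 2 : ℝ) ≤ c ^ (-θ) := by
      calc (1 / 2 : ℝ) = 2 ^ (-1 : ℝ) := by rw [Real.rpow_neg_one]; norm_num
        _ ≤ 2 ^ (-θ) := Real.rpow_le_rpow_of_exponent_le (by norm_num) (by linarith)
        _ ≤ c ^ (-θ) := Real.rpow_le_rpow_of_nonpos hc h.le (by linarith)
    nlinarith



/-- The integrand centred at -η equals 1 at η while its integral is O(1/c), and c is arbitrary. This
discards ξ = -η, where the kernel would be evaluated at the origin. -/
lemma sigma_singleton (η : S2) : sigma {η} = 0 := by
  obtain ⟨C, hC, h⟩ := exists_lintegral_sphere_exp_le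
  have hle : ∀ n : ℕ, sigma {η} ≤ ENNReal.ofReal (C * ((n : ℝ) + 1)⁻¹) := by
    intro n
    have h1 := h 1 zero_le_one le_rfl (n + 1) (by positivity) (-η)
    rw [Real.rpow_neg_one] at h1
    refine le_trans ?_ h1
    calc sigma {η} = ∫⁻ ξ in {η}, 1 ∂sigma := by simp
      _ ≤ ∫⁻ ξ in {η}, ENNReal.ofReal
            (Real.exp (-(((n : ℝ) + 1) * ‖(ξ : R3) + ((-η : S2) : R3)‖ ^ 2))) ∂sigma := by
          refine setLIntegral_mono' (measurableSet_singleton η) fun ξ hξ => ?_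
          rw [mem_singleton_iff.1 hξ]
          simp
      _ ≤ _ := setLIntegral_le_lintegral _ _
  have hlim : Filter.Tendsto (fun n : ℕ => ENNReal.ofReal (C * ((n : ℝ) + 1)⁻¹)) Filter.atTop
      (nhds 0) := by
    rw [← ENNReal.ofReal_zero]
    apply ENNReal.tendsto_ofReal
    have := (tendsto_one_div_add_atTop_nhds_zero_nat (𝕜 := ℝ)).const_mul C
    simpa using this
  exact le_antisymm (ge_of_tendsto' hlim hle) zero_le

/-! ### The Bessel kernel as a mixture of Gaussians -/

/-- The mixing weight `t ↦ t^{(α-5)/2} e^{-t}` of the Bessel kernel. -/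
def besselWeight (α t : ℝ) : ℝ := t ^ ((α - 5) / 2) * Real.exp (-t)

/-- The Gaussian `x ↦ e^{-|x|²/(4t)}`. -/
def gauss (t : ℝ) (x : R3) : ℝ := Real.exp (-(‖x‖ ^ 2 / (4 * t)))

lemma besselWeight_nonneg (α : ℝ) {t : ℝ} (ht : 0 < t) : 0 ≤ besselWeight α t := by
  unfold besselWeight; positivity

lemma besselIntegrand_eq (α : ℝ) (x : R3) (t : ℝ) :
    besselIntegrand α x t = besselWeight α t * gauss t x := rfl

@[fun_prop]
lemma measurable_besselWeight (α : ℝ) : Measurable (besselWeight α) := by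
  unfold besselWeight; fun_prop

@[fun_prop]
lemma Measurable.gauss {X : Type*} [MeasurableSpace X] {u : X → ℝ} {v : X → R3}
    (hu : Measurable u) (hv : Measurable v) : Measurable fun x => gauss (u x) (v x) := by
  unfold StochWave.gauss; fun_prop

lemma gauss_nonneg (t : ℝ) (x : R3) : 0 ≤ gauss t x := (Real.exp_pos _).le

lemma gauss_le_one {t : ℝ} (ht : 0 < t) (x : R3) : gauss t x ≤ 1 := by
  apply Real.exp_le_one_iff.2
  have : 0 ≤ ‖x‖ ^ 2 / (4 * t) := by positivity
  linarith

lemma integrableOn_besselWeight_mul_rpow {α p : ℝ} (hp : -1 < (α - 5) / 2 + p) :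
    IntegrableOn (fun t => besselWeight α t * t ^ p) (Ioi 0) := by
  have h := Real.GammaIntegral_convergent (s := (α - 5) / 2 + p + 1) (by linarith)
  refine h.congr_fun (fun t ht => ?_) measurableSet_Ioi
  have ht0 : 0 < t := ht
  simp only [besselWeight]
  rw [show (α - 5) / 2 + p + 1 - 1 = (α - 5) / 2 + p by ring, Real.rpow_add ht0]
  ring

/-- With a = |x|²/4 > 0, the bound e^{-a/t} ≤ n! (t/a)^n beats the singularity of the weight at t =
0 once n > (3-α)/2. -/
lemma integrableOn_besselIntegrand (α : ℝ) {x : R3} (hx : x ≠ 0) :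
    IntegrableOn (besselIntegrand α x) (Ioi 0) := by
  obtain ⟨n, hn⟩ := exists_nat_gt ((3 - α) / 2)
  have hn1 : -1 < (α - 5) / 2 + n := by linarith
  have hx0 : 0 < ‖x‖ ^ 2 / 4 := by have := norm_pos_iff.2 hx; positivity
  set a := ‖x‖ ^ 2 / 4
  have hmeas : Measurable (besselIntegrand α x) := by
    simp only [funext (besselIntegrand_eq α x)]
    fun_prop
  refine Integrable.mono' ((integrableOn_besselWeight_mul_rpow hn1).const_mul (n.factorial / a ^ n))
    hmeas.aestronglyMeasurable ?_
  refine (ae_restrict_iff' measurableSet_Ioi).2 (Filter.Eventually.of_forall fun t ht => ?_)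
  have ht0 : 0 < t := ht
  have hW := besselWeight_nonneg α ht0
  rw [besselIntegrand_eq, Real.norm_of_nonneg (mul_nonneg hW (gauss_nonneg _ _))]
  have h1 : (a / t) ^ n / n.factorial ≤ Real.exp (a / t) :=
    Real.pow_div_factorial_le_exp _ (by positivity) n
  have h2 : gauss t x = (Real.exp (a / t))⁻¹ := by
    rw [gauss, Real.exp_neg]
    congr 2
    simp only [a]; field_simp
  have h3 : gauss t x ≤ n.factorial / a ^ n * t ^ (n : ℝ) := by
    rw [h2, Real.rpow_natCast]
    refine (inv_anti₀ (by positivity) h1).trans (le_of_eq ?_)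
    rw [div_pow]
    field_simp
  calc _ ≤ besselWeight α t * (n.factorial / a ^ n * t ^ (n : ℝ)) := by gcongr
    _ = _ := by ring

lemma measurable_besselKernel (α : ℝ) : Measurable (besselKernel α) := by
  have h : Measurable (Function.uncurry (besselIntegrand α)) := by
    simp only [Function.uncurry_def, besselIntegrand_eq]
    fun_prop
  exact (h.stronglyMeasurable.integral_prod_right' (ν := volume.restrict (Ioi (0 : ℝ)))).measurable

lemma besselKernel_nonneg (α : ℝ) (x : R3) : 0 ≤ besselKernel α x := by
  refine setIntegral_nonneg measurableSet_Ioi fun t ht => ?_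
  exact mul_nonneg (besselWeight_nonneg α ht) (gauss_nonneg _ _)

lemma ofReal_abs_setIntegral_le (u : ℝ → ℝ) :
    ENNReal.ofReal |∫ t in Ioi (0 : ℝ), u t| ≤ ∫⁻ t in Ioi (0 : ℝ), ENNReal.ofReal |u t| := by
  have := enorm_integral_le_lintegral_enorm (μ := volume.restrict (Ioi (0 : ℝ))) u
  simpa only [Real.enorm_eq_ofReal_abs] using this

lemma lintegral_abs_besselWeight_mul (α : ℝ) (u : ℝ → ℝ) :
    ∫⁻ t in Ioi (0 : ℝ), ENNReal.ofReal |besselWeight α t * u t| =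
      ∫⁻ t in Ioi (0 : ℝ), ENNReal.ofReal (besselWeight α t * |u t|) := by
  refine setLIntegral_congr_fun measurableSet_Ioi fun t ht => ?_
  simp only [abs_mul, abs_of_nonneg (besselWeight_nonneg α ht)]

/-- This holds even at x = 0, where the default value 0 of a divergent integral does no harm. The
difference versions below exclude the origin, because splitting the integral requires each term to
converge. -/
lemma ofReal_abs_besselKernel_le (α : ℝ) (x : R3) :
    ENNReal.ofReal |besselKernel α x| ≤
      ∫⁻ t in Ioi (0 : ℝ), ENNReal.ofReal (besselWeight α t * |gauss t x|) := by
  rw [← lintegral_abs_besselWeight_mul]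
  exact ofReal_abs_setIntegral_le _

lemma ofReal_abs_besselKernel_sub_le (α : ℝ) {x y : R3} (hx : x ≠ 0) (hy : y ≠ 0) :
    ENNReal.ofReal |besselKernel α x - besselKernel α y| ≤
      ∫⁻ t in Ioi (0 : ℝ), ENNReal.ofReal (besselWeight α t * |gauss t x - gauss t y|) := by
  rw [← lintegral_abs_besselWeight_mul]
  unfold besselKernel
  rw [← integral_sub (integrableOn_besselIntegrand α hx) (integrableOn_besselIntegrand α hy)]
  refine (ofReal_abs_setIntegral_le _).trans (le_of_eq ?_)
  simp only [besselIntegrand_eq, mul_sub]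

lemma ofReal_abs_besselKernel_second_le (α : ℝ) {x y y' z : R3} (hx : x ≠ 0) (hy : y ≠ 0)
    (hy' : y' ≠ 0) (hz : z ≠ 0) :
    ENNReal.ofReal |besselKernel α x - besselKernel α y - besselKernel α y' + besselKernel α z| ≤
      ∫⁻ t in Ioi (0 : ℝ), ENNReal.ofReal
        (besselWeight α t * |gauss t x - gauss t y - gauss t y' + gauss t z|) := by
  rw [← lintegral_abs_besselWeight_mul]
  unfold besselKernel
  have ix := integrableOn_besselIntegrand α hx
  have iy := integrableOn_besselIntegrand α hy
  have iy' := integrableOn_besselIntegrand α hy'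
  have iz := integrableOn_besselIntegrand α hz
  have i1 : IntegrableOn (fun t => besselIntegrand α x t - besselIntegrand α y t) (Ioi 0) :=
    ix.sub iy
  have i2 : IntegrableOn (fun t => besselIntegrand α y' t - besselIntegrand α z t) (Ioi 0) :=
    iy'.sub iz
  rw [show ∀ a b c d : ℝ, a - b - c + d = (a - b) - (c - d) by intros; ring,
    ← integral_sub ix iy, ← integral_sub iy' iz, ← integral_sub i1 i2]
  refine (ofReal_abs_setIntegral_le _).trans (le_of_eq ?_)
  refine lintegral_congr fun t => ?_
  simp only [besselIntegrand_eq]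
  congr 2
  ring

/-- The moment `∫₀^∞ t^p t^{(α-5)/2} e^{-t} dt`. -/
def besselMoment (α p : ℝ) : ℝ := ∫ t in Ioi (0 : ℝ), besselWeight α t * t ^ p

lemma besselMoment_nonneg (α p : ℝ) : 0 ≤ besselMoment α p :=
  setIntegral_nonneg measurableSet_Ioi fun _ ht =>
    mul_nonneg (besselWeight_nonneg α ht) (Real.rpow_nonneg (le_of_lt ht) _)

/-- If `Φ` is dominated by a mixture of the functions `G t`, whose integrals grow at most like
`t^p`, then the integral of `Φ` is controlled by the `p`-th moment of the mixing weight. -/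
lemma lintegral_le_besselMoment {X : Type*} [MeasurableSpace X] {μ : Measure X} [SFinite μ]
    {α p A : ℝ} {Φ : X → ENNReal} {G : ℝ → X → ℝ} (hG : Measurable (Function.uncurry G))
    (hp : -1 < (α - 5) / 2 + p) (hA : 0 ≤ A)
    (hΦ : ∀ᵐ x ∂μ, Φ x ≤ ∫⁻ t in Ioi (0 : ℝ), ENNReal.ofReal (besselWeight α t * G t x))
    (hJ : ∀ t : ℝ, 0 < t → ∫⁻ x, ENNReal.ofReal (G t x) ∂μ ≤ ENNReal.ofReal (A * t ^ p)) :
    ∫⁻ x, Φ x ∂μ ≤ ENNReal.ofReal (A * besselMoment α p) := by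
  calc ∫⁻ x, Φ x ∂μ
      ≤ ∫⁻ x, ∫⁻ t in Ioi (0 : ℝ), ENNReal.ofReal (besselWeight α t * G t x) ∂volume ∂μ :=
        lintegral_mono_ae hΦ
    _ = ∫⁻ t in Ioi (0 : ℝ), ∫⁻ x, ENNReal.ofReal (besselWeight α t * G t x) ∂μ := by
        apply lintegral_lintegral_swap
        apply Measurable.aemeasurable
        have h : Measurable fun q : X × ℝ => G q.2 q.1 := hG.comp measurable_swap
        simp only [Function.uncurry_def]
        fun_prop
    _ ≤ ∫⁻ t in Ioi (0 : ℝ), ENNReal.ofReal (A * (besselWeight α t * t ^ p)) := by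
        refine setLIntegral_mono' measurableSet_Ioi fun t ht => ?_
        have hW := besselWeight_nonneg α ht
        simp only [ENNReal.ofReal_mul hW]
        rw [lintegral_const_mul' _ _ ENNReal.ofReal_ne_top]
        refine (mul_le_mul_right (hJ t ht) _).trans (le_of_eq ?_)
        rw [← ENNReal.ofReal_mul hW]
        congr 1
        ring
    _ = ENNReal.ofReal (A * besselMoment α p) := by
        rw [besselMoment, ← integral_const_mul, ofReal_integral_eq_lintegral_ofReal]
        · exact (integrableOn_besselWeight_mul_rpow hp).const_mul A
        · refine (ae_restrict_iff' measurableSet_Ioi).2 (Filter.Eventually.of_forall fun _ ht => ?_)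
          exact mul_nonneg hA (mul_nonneg (besselWeight_nonneg α ht)
            (Real.rpow_nonneg (le_of_lt ht) _))


/-! ### Spatial increments -/

/-- From |z+2w|² ≥ 0 follows |z+w|² ≥ |z|²/2 - |w|²; the loss |w|² ≤ t is the 1/4 after division by
4t. -/
lemma gauss_add_lower {t : ℝ} (ht : 0 < t) {z w : R3} (hw : ‖w‖ ^ 2 / t ≤ 1) :
    ‖z‖ ^ 2 / (4 * t) / 2 - 1 / 4 ≤ ‖z + w‖ ^ 2 / (4 * t) := by
  have h1 := norm_add_sq_real z w
  have h2 := norm_add_sq_real z ((2 : ℝ) • w)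
  rw [norm_smul, inner_smul_right] at h2
  norm_num at h2
  have h3 := sq_nonneg ‖z + (2 : ℝ) • w‖
  rw [div_le_one ht] at hw
  rw [← sub_nonneg]
  have : ‖z + w‖ ^ 2 / (4 * t) - (‖z‖ ^ 2 / (4 * t) / 2 - 1 / 4) =
      (‖z + w‖ ^ 2 - ‖z‖ ^ 2 / 2 + t) / (4 * t) := by
    field_simp
    ring
  rw [this]
  apply div_nonneg _ (by linarith)
  nlinarith

lemma inner_div_sq_le {t : ℝ} (ht : 0 < t) (z w : R3) :
    (|inner ℝ z w| / (2 * t)) ^ 2 ≤ ‖w‖ ^ 2 / t * (‖z‖ ^ 2 / (4 * t)) := by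
  have h := abs_real_inner_le_norm z w
  calc _ ≤ (‖z‖ * ‖w‖ / (2 * t)) ^ 2 := by gcongr
    _ = _ := by field_simp; norm_num

lemma abs_gauss_add_sub_le {t : ℝ} (ht : 0 < t) {z w : R3} (hw0 : w ≠ 0)
    (hw : ‖w‖ ^ 2 / t ≤ 1) {γ : ℝ} (hγ : γ ≤ 1) :
    |gauss t (z + w) - gauss t z| ≤
      12 * (‖w‖ ^ 2 / t) ^ (γ / 2) * Real.exp (-(‖z‖ ^ 2 / (16 * t))) := by
  have hw1 := norm_pos_iff.2 hw0
  have hD : 0 ≤ ‖z‖ ^ 2 / (4 * t) := by positivity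
  have h := exp_increment_le (p := |inner ℝ z w| / (2 * t)) (a := ‖z + w‖ ^ 2 / (4 * t))
    (b := ‖z‖ ^ 2 / (4 * t)) hD (by positivity) hw (inner_div_sq_le ht z w)
    (gauss_add_lower ht hw) (by linarith) ?_ hγ
  · rwa [show ‖z‖ ^ 2 / (4 * t) / 4 = ‖z‖ ^ 2 / (16 * t) by field_simp; norm_num] at h
  · rw [norm_add_sq_real]
    have e : (‖z‖ ^ 2 + 2 * inner ℝ z w + ‖w‖ ^ 2) / (4 * t) - ‖z‖ ^ 2 / (4 * t) =
        inner ℝ z w / (2 * t) + ‖w‖ ^ 2 / t / 4 := by field_simp; ring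
    have h0 : 0 ≤ ‖w‖ ^ 2 / t := by positivity
    rw [e]
    refine (abs_add_le _ _).trans ?_
    rw [abs_div, abs_of_pos (show 0 < 2 * t by linarith),
      abs_of_nonneg (show 0 ≤ ‖w‖ ^ 2 / t / 4 by linarith)]
    linarith

lemma abs_gauss_add_add_sub_le {t : ℝ} (ht : 0 < t) {z w : R3} (hw0 : w ≠ 0)
    (hw : ‖w‖ ^ 2 / t ≤ 1) {γ : ℝ} (hγ : γ ≤ 2) :
    |gauss t (z + w) - gauss t z - gauss t z + gauss t (z - w)| ≤
      12 * (‖w‖ ^ 2 / t) ^ (γ / 2) * Real.exp (-(‖z‖ ^ 2 / (16 * t))) := by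
  have hw1 := norm_pos_iff.2 hw0
  have hD : 0 ≤ ‖z‖ ^ 2 / (4 * t) := by positivity
  have hlow := gauss_add_lower (z := z) (w := -w) ht (by rwa [norm_neg])
  rw [← sub_eq_add_neg] at hlow
  have h := exp_second_increment_le (a := ‖z + w‖ ^ 2 / (4 * t)) (b := ‖z‖ ^ 2 / (4 * t))
    (d := ‖z - w‖ ^ 2 / (4 * t)) (D := ‖z‖ ^ 2 / (4 * t)) (by positivity) hw
    (gauss_add_lower ht hw) (by linarith) hlow ?_ hγ
  · rw [show ‖z‖ ^ 2 / (4 * t) / 4 = ‖z‖ ^ 2 / (16 * t) by field_simp; norm_num] at h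
    rw [show gauss t (z + w) - gauss t z - gauss t z + gauss t (z - w) =
      gauss t (z + w) - 2 * gauss t z + gauss t (z - w) by ring]
    exact h
  · have h1 := inner_div_sq_le ht z w
    rw [div_pow, sq_abs] at h1
    have h0 : 0 ≤ ‖w‖ ^ 2 / t := by positivity
    rw [norm_add_sq_real, norm_sub_sq_real]
    have e1 : ((‖z‖ ^ 2 + 2 * inner ℝ z w + ‖w‖ ^ 2) / (4 * t) -
        (‖z‖ ^ 2 - 2 * inner ℝ z w + ‖w‖ ^ 2) / (4 * t)) ^ 2 / 4 =
        inner ℝ z w ^ 2 / (2 * t) ^ 2 := by field_simp; ring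
    have e2 : (‖z‖ ^ 2 + 2 * inner ℝ z w + ‖w‖ ^ 2) / (4 * t) +
        (‖z‖ ^ 2 - 2 * inner ℝ z w + ‖w‖ ^ 2) / (4 * t) - 2 * (‖z‖ ^ 2 / (4 * t)) =
        ‖w‖ ^ 2 / t / 2 := by field_simp; ring
    rw [e1, e2, abs_of_nonneg (by linarith)]
    nlinarith [mul_nonneg h0 hD]

/-- If z is the point nearer to the origin, the Gaussian is larger at z; otherwise 1/|z| ≤ 1/|z+w|.
Integrating and using translation invariance makes the bound for a shifted Gaussian uniform in w. -/
lemma gauss_add_div_norm_le {t : ℝ} (ht : 0 < t) (z w : R3) (hz : z ≠ 0) (hzw : z + w ≠ 0) :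
    gauss t (z + w) / ‖z‖ ≤ gauss t (z + w) / ‖z + w‖ + gauss t z / ‖z‖ := by
  have h1 : 0 < ‖z‖ := norm_pos_iff.2 hz
  have h2 : 0 < ‖z + w‖ := norm_pos_iff.2 hzw
  rcases le_total ‖z‖ ‖z + w‖ with h | h
  · have : gauss t (z + w) ≤ gauss t z := by
      apply Real.exp_le_exp.2
      apply neg_le_neg
      gcongr
    have h3 : gauss t (z + w) / ‖z‖ ≤ gauss t z / ‖z‖ := by gcongr
    have h4 : 0 ≤ gauss t (z + w) / ‖z + w‖ := div_nonneg (gauss_nonneg _ _) h2.le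
    linarith
  · have h3 : gauss t (z + w) / ‖z‖ ≤ gauss t (z + w) / ‖z + w‖ := by
      have := gauss_nonneg t (z + w)
      gcongr
    have h4 : 0 ≤ gauss t z / ‖z‖ := div_nonneg (gauss_nonneg _ _) h1.le
    linarith

lemma ae_add_ne_zero (w : R3) : ∀ᵐ z : R3, z + w ≠ 0 := by
  have : ∀ᵐ z : R3, z ∉ ({-w} : Set R3) := measure_eq_zero_iff_ae_notMem.1 (by simp)
  filter_upwards [this] with z hz h
  exact hz (eq_neg_of_add_eq_zero_left h)

lemma ae_ne_zero : ∀ᵐ z : R3, z ≠ 0 := by simpa using ae_add_ne_zero 0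

lemma lintegral_gauss_add_div_norm_le {C : ℝ} (h : ∀ b : ℝ, 0 < b →
      ∫⁻ z : R3, ENNReal.ofReal (Real.exp (-(‖z‖ ^ 2 / b)) / ‖z‖) ≤ ENNReal.ofReal (C * b))
    {t : ℝ} (ht : 0 < t) (w : R3) :
    ∫⁻ z : R3, ENNReal.ofReal (gauss t (z + w) / ‖z‖) ≤ ENNReal.ofReal (C * (8 * t)) := by
  have h0 := h (4 * t) (by linarith)
  calc _ ≤ ∫⁻ z : R3, (ENNReal.ofReal (gauss t (z + w) / ‖z + w‖) +
          ENNReal.ofReal (gauss t z / ‖z‖)) := by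
        apply lintegral_mono_ae
        filter_upwards [ae_add_ne_zero w, ae_ne_zero] with z hzw hz
        rw [← ENNReal.ofReal_add (div_nonneg (gauss_nonneg _ _) (norm_nonneg _))
          (div_nonneg (gauss_nonneg _ _) (norm_nonneg _))]
        exact ENNReal.ofReal_le_ofReal (gauss_add_div_norm_le ht z w hz hzw)
    _ = 2 * ∫⁻ z : R3, ENNReal.ofReal (gauss t z / ‖z‖) := by
        rw [lintegral_add_right _ (by fun_prop),
          lintegral_add_right_eq_self (fun z : R3 => ENNReal.ofReal (gauss t z / ‖z‖)) w, two_mul]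
    _ ≤ 2 * ENNReal.ofReal (C * (4 * t)) := by gcongr; exact h0
    _ = _ := by
        rw [← ENNReal.ofReal_ofNat, ← ENNReal.ofReal_mul (by norm_num)]
        congr 1; ring

lemma rpow_scale {H t γ : ℝ} (hH : 0 < H) (ht : 0 < t) :
    t * (H ^ 2 / t) ^ (γ / 2) = H ^ γ * t ^ (1 - γ / 2) := by
  rw [Real.div_rpow (by positivity) ht.le, ← Real.rpow_natCast, ← Real.rpow_mul hH.le,
    Real.rpow_sub ht, Real.rpow_one]
  rw [show ((2 : ℕ) : ℝ) * (γ / 2) = γ by push_cast; ring]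
  ring

/-- Interpolation between a small-increment bound and a trivial bound. -/
lemma lintegral_increment_div_norm_le {C : ℝ} (hC : 0 ≤ C) (h : ∀ b : ℝ, 0 < b →
      ∫⁻ z : R3, ENNReal.ofReal (Real.exp (-(‖z‖ ^ 2 / b)) / ‖z‖) ≤ ENNReal.ofReal (C * b))
    {t γ : ℝ} (ht : 0 < t) (hγ : 0 ≤ γ) {w : R3} (hw : w ≠ 0) {u : R3 → ℝ}
    (hsmall : ‖w‖ ^ 2 / t ≤ 1 → ∀ z,
      |u z| ≤ 12 * (‖w‖ ^ 2 / t) ^ (γ / 2) * Real.exp (-(‖z‖ ^ 2 / (16 * t))))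
    (hlarge : ∀ z, |u z| ≤ gauss t (z + w) + gauss t (z + -w) + 2 * gauss t (z + 0)) :
    ∫⁻ z : R3, ENNReal.ofReal (|u z| / ‖z‖) ≤
      ENNReal.ofReal (192 * C * ‖w‖ ^ γ * t ^ (1 - γ / 2)) := by
  have hw0 := norm_pos_iff.2 hw
  have e : 192 * C * ‖w‖ ^ γ * t ^ (1 - γ / 2) = 192 * C * (t * (‖w‖ ^ 2 / t) ^ (γ / 2)) := by
    rw [rpow_scale hw0 ht]; ring
  rw [e]
  -- For |w|² ≤ t the increment bound gives 12 · 16 = 192. Otherwise the four Gaussians contribute 4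
  -- · 8Ct = 32Ct, and (|w|²/t)^{γ/2} ≥ 1 only helps.
  rcases le_or_gt (‖w‖ ^ 2 / t) 1 with hk | hk
  · calc _ ≤ ∫⁻ z : R3, ENNReal.ofReal (12 * (‖w‖ ^ 2 / t) ^ (γ / 2)) *
            ENNReal.ofReal (Real.exp (-(‖z‖ ^ 2 / (16 * t))) / ‖z‖) := by
          refine lintegral_mono fun z => ?_
          rw [← ENNReal.ofReal_mul (by positivity), ← mul_div_assoc]
          apply ENNReal.ofReal_le_ofReal
          gcongr
          exact hsmall hk z
      _ ≤ ENNReal.ofReal (12 * (‖w‖ ^ 2 / t) ^ (γ / 2)) * ENNReal.ofReal (C * (16 * t)) := by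
          rw [lintegral_const_mul' _ _ ENNReal.ofReal_ne_top]
          gcongr
          exact h _ (by linarith)
      _ = _ := by
          rw [← ENNReal.ofReal_mul (by positivity)]
          congr 1; ring
  · have h1 := lintegral_gauss_add_div_norm_le h ht
    calc _ ≤ ∫⁻ z : R3, (ENNReal.ofReal (gauss t (z + w) / ‖z‖) +
            ENNReal.ofReal (gauss t (z + -w) / ‖z‖) +
              (ENNReal.ofReal (gauss t (z + 0) / ‖z‖) +
                ENNReal.ofReal (gauss t (z + 0) / ‖z‖))) := by
          refine lintegral_mono fun z => ?_
          have g1 := div_nonneg (gauss_nonneg t (z + w)) (norm_nonneg z)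
          have g2 := div_nonneg (gauss_nonneg t (z + -w)) (norm_nonneg z)
          have g3 := div_nonneg (gauss_nonneg t (z + 0)) (norm_nonneg z)
          rw [← ENNReal.ofReal_add g1 g2, ← ENNReal.ofReal_add g3 g3,
            ← ENNReal.ofReal_add (by positivity) (by positivity)]
          apply ENNReal.ofReal_le_ofReal
          calc _ ≤ (gauss t (z + w) + gauss t (z + -w) + 2 * gauss t (z + 0)) / ‖z‖ := by
                gcongr; exact hlarge z
            _ = _ := by ring
      _ ≤ ENNReal.ofReal (C * (8 * t)) + ENNReal.ofReal (C * (8 * t)) +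
            (ENNReal.ofReal (C * (8 * t)) + ENNReal.ofReal (C * (8 * t))) := by
          rw [lintegral_add_right _ (by fun_prop), lintegral_add_right _ (by fun_prop),
            lintegral_add_right _ (by fun_prop)]
          gcongr <;> apply h1
      _ = ENNReal.ofReal (32 * C * t) := by
          rw [← ENNReal.ofReal_add (by positivity) (by positivity),
            ← ENNReal.ofReal_add (by positivity) (by positivity)]
          congr 1; ring
      _ ≤ _ := by
          apply ENNReal.ofReal_le_ofReal
          have h2 : 1 ≤ (‖w‖ ^ 2 / t) ^ (γ / 2) := Real.one_le_rpow hk.le (by linarith)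
          have h3 : 0 ≤ C * t := by positivity
          nlinarith

lemma ofReal_div_norm_le {α : ℝ} {r : ℝ} {z : R3} {u : ℝ → ℝ}
    (h : ENNReal.ofReal |r| ≤ ∫⁻ t in Ioi (0 : ℝ), ENNReal.ofReal (besselWeight α t * |u t|)) :
    ENNReal.ofReal (|r| / ‖z‖) ≤
      ∫⁻ t in Ioi (0 : ℝ), ENNReal.ofReal (besselWeight α t * (|u t| / ‖z‖)) := by
  have e : ∀ x : ℝ, ENNReal.ofReal (x / ‖z‖) = ENNReal.ofReal ‖z‖⁻¹ * ENNReal.ofReal x := by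
    intro x
    rw [← ENNReal.ofReal_mul (by positivity)]; congr 1; ring
  simp only [← mul_div_assoc, e]
  rw [lintegral_const_mul' _ _ ENNReal.ofReal_ne_top]
  gcongr

lemma spaceCond1_besselKernel {α : ℝ} (T : ℝ) {γ : ℝ} (h0 : 0 < γ) (h1 : γ < min (α - 1) 1) :
    SpaceCond1 (besselKernel α) T γ := by
  obtain ⟨hα, hγ1⟩ := lt_min_iff.1 h1
  obtain ⟨C, hC, h⟩ := exists_lintegral_exp_neg_div_norm_le
  refine ⟨192 * C * besselMoment α (1 - γ / 2), fun w => ?_⟩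
  rcases eq_or_ne w 0 with rfl | hw
  · simp
  -- The estimate holds over all of ℝ³, so the constant does not involve T. The moment condition
  -- (α-5)/2 + 1 - γ/2 > -1 is exactly γ < α-1.
  refine (setLIntegral_le_lintegral _ _).trans ?_
  have := lintegral_le_besselMoment (μ := (volume : Measure R3)) (α := α) (p := 1 - γ / 2)
    (A := 192 * C * ‖w‖ ^ γ)
    (Φ := fun z => ENNReal.ofReal (|besselKernel α (z + w) - besselKernel α z| / ‖z‖))
    (G := fun t z => |gauss t (z + w) - gauss t z| / ‖z‖)
    (by simp only [Function.uncurry_def, ← Real.norm_eq_abs]; fun_prop)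
    (by linarith) (by positivity) ?_ ?_
  · refine this.trans (le_of_eq ?_)
    congr 1; ring
  · filter_upwards [ae_add_ne_zero w, ae_ne_zero] with z hzw hz
    exact ofReal_div_norm_le (ofReal_abs_besselKernel_sub_le α hzw hz)
  · intro t ht
    refine lintegral_increment_div_norm_le hC h ht h0.le hw
      (fun hk z => abs_gauss_add_sub_le ht hw hk hγ1.le) fun z => ?_
    rw [add_zero]
    have g1 := gauss_nonneg t (z + w)
    have g2 := gauss_nonneg t (z + -w)
    have g3 := gauss_nonneg t z
    rw [abs_le]
    constructor <;> linarith

lemma spaceCond2_besselKernel {α : ℝ} (T : ℝ) {γ : ℝ} (h0 : 0 < γ) (h1 : γ < min (α - 1) 2) :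
    SpaceCond2 (besselKernel α) T γ := by
  obtain ⟨hα, hγ1⟩ := lt_min_iff.1 h1
  obtain ⟨C, hC, h⟩ := exists_lintegral_exp_neg_div_norm_le
  refine ⟨192 * C * besselMoment α (1 - γ / 2), fun w => ?_⟩
  rcases eq_or_ne w 0 with rfl | hw
  · simp [two_mul]
  refine (setLIntegral_le_lintegral _ _).trans ?_
  have := lintegral_le_besselMoment (μ := (volume : Measure R3)) (α := α) (p := 1 - γ / 2)
    (A := 192 * C * ‖w‖ ^ γ)
    (Φ := fun z => ENNReal.ofReal
      (|besselKernel α (z + w) + besselKernel α (z - w) - 2 * besselKernel α z| / ‖z‖))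
    (G := fun t z => |gauss t (z + w) - gauss t z - gauss t z + gauss t (z - w)| / ‖z‖)
    (by simp only [Function.uncurry_def, ← Real.norm_eq_abs]; fun_prop)
    (by linarith) (by positivity) ?_ ?_
  · refine this.trans (le_of_eq ?_)
    congr 1; ring
  · filter_upwards [ae_add_ne_zero w, ae_add_ne_zero (-w), ae_ne_zero] with z hzw hzw' hz
    rw [← sub_eq_add_neg] at hzw'
    have := ofReal_div_norm_le (z := z) (ofReal_abs_besselKernel_second_le α hzw hz hz hzw')
    rwa [show besselKernel α (z + w) - besselKernel α z - besselKernel α z +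
      besselKernel α (z - w) = besselKernel α (z + w) + besselKernel α (z - w) -
        2 * besselKernel α z by ring] at this
  · intro t ht
    refine lintegral_increment_div_norm_le hC h ht h0.le hw
      (fun hk z => abs_gauss_add_add_sub_le ht hw hk hγ1.le) fun z => ?_
    rw [add_zero, ← sub_eq_add_neg]
    have g1 := gauss_nonneg t (z + w)
    have g2 := gauss_nonneg t (z - w)
    have g3 := gauss_nonneg t z
    rw [abs_le]
    constructor <;> linarith

/-! ### Small balls -/

/-- One Gaussian contributes a multiple of min(r², t) ≤ t (r²/t)^{ν/2}. The case ν = 0 is kept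
because it yields integrability on balls. -/
lemma exists_lintegral_closedBall_besselKernel_le {α ν : ℝ} (h0 : 0 ≤ ν) (hα : ν < α - 1)
    (hν2 : ν ≤ 2) : ∃ C : ℝ, ∀ r : ℝ, 0 < r →
    ∫⁻ z in Metric.closedBall (0 : R3) r, ENNReal.ofReal (besselKernel α z / ‖z‖) ≤
      ENNReal.ofReal (C * r ^ ν) := by
  obtain ⟨C, hC, h⟩ := exists_lintegral_exp_neg_div_norm_le
  refine ⟨4 * C * besselMoment α (1 - ν / 2), fun r hr => ?_⟩
  have := lintegral_le_besselMoment (μ := (volume : Measure R3).restrict (Metric.closedBall 0 r))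
    (α := α) (p := 1 - ν / 2) (A := 4 * C * r ^ ν)
    (Φ := fun z => ENNReal.ofReal (besselKernel α z / ‖z‖))
    (G := fun t z => |gauss t z| / ‖z‖)
    (by simp only [Function.uncurry_def, ← Real.norm_eq_abs]; fun_prop)
    (by linarith) (by positivity) ?_ ?_
  · refine this.trans (le_of_eq ?_)
    congr 1; ring
  · refine Filter.Eventually.of_forall fun z => ?_
    have := ofReal_div_norm_le (z := z) (ofReal_abs_besselKernel_le α z)
    rwa [abs_of_nonneg (besselKernel_nonneg α z)] at this
  · intro t ht
    have e : 4 * C * r ^ ν * t ^ (1 - ν / 2) = 4 * C * (t * (r ^ 2 / t) ^ (ν / 2)) := by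
      rw [rpow_scale hr ht]; ring
    rw [e]
    have hk0 : 0 < r ^ 2 / t := by positivity
    simp only [abs_of_nonneg (gauss_nonneg _ _)]
    rcases le_or_gt (r ^ 2 / t) 1 with hk | hk
    -- On the ball, 1 ≤ e · e^{-|z|²/r²}, so the Gaussian integral with b = r² also gives the
    -- volume-type bound r².
    · calc _ ≤ ∫⁻ z in Metric.closedBall (0 : R3) r, ENNReal.ofReal (Real.exp 1) *
              ENNReal.ofReal (Real.exp (-(‖z‖ ^ 2 / r ^ 2)) / ‖z‖) := by
            refine setLIntegral_mono' Metric.isClosed_closedBall.measurableSet fun z hz => ?_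
            rw [← ENNReal.ofReal_mul (by positivity), ← mul_div_assoc, ← Real.exp_add]
            apply ENNReal.ofReal_le_ofReal
            gcongr
            refine (gauss_le_one ht z).trans (Real.one_le_exp ?_)
            have hz' : ‖z‖ ≤ r := by simpa using hz
            have : ‖z‖ ^ 2 / r ^ 2 ≤ 1 := by
              rw [div_le_one (by positivity)]
              gcongr
            linarith
        _ ≤ ENNReal.ofReal (Real.exp 1) * ENNReal.ofReal (C * r ^ 2) := by
            rw [lintegral_const_mul' _ _ ENNReal.ofReal_ne_top]
            gcongr
            exact (setLIntegral_le_lintegral _ _).trans (h _ (by positivity))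
        _ ≤ _ := by
            rw [← ENNReal.ofReal_mul (by positivity)]
            apply ENNReal.ofReal_le_ofReal
            have h2 : r ^ 2 / t ≤ (r ^ 2 / t) ^ (ν / 2) := by
              nth_rewrite 1 [← Real.rpow_one (r ^ 2 / t)]
              exact Real.rpow_le_rpow_of_exponent_ge hk0 hk (by linarith)
            have h3 : r ^ 2 = t * (r ^ 2 / t) := by field_simp
            have h4 : Real.exp 1 ≤ 4 := by linarith [Real.exp_one_lt_d9]
            calc _ = Real.exp 1 * C * (t * (r ^ 2 / t)) := by rw [← h3]; ring
              _ ≤ _ := by gcongr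
    · refine (setLIntegral_le_lintegral _ _).trans ((h (4 * t) (by linarith)).trans ?_)
      apply ENNReal.ofReal_le_ofReal
      have h2 : 1 ≤ (r ^ 2 / t) ^ (ν / 2) := Real.one_le_rpow hk.le (by linarith)
      have h3 : 0 ≤ C * t := by positivity
      nlinarith

lemma integrableOn_besselKernel_div_norm {α : ℝ} (hα : 1 < α) {r : ℝ} (hr : 0 < r) :
    IntegrableOn (fun z => besselKernel α z / ‖z‖) (Metric.closedBall 0 r) := by
  obtain ⟨C, hC⟩ := exists_lintegral_closedBall_besselKernel_le (α := α) (ν := 0) le_rfl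
    (by linarith) (by norm_num)
  have hm := measurable_besselKernel α
  refine ⟨Measurable.aestronglyMeasurable (by fun_prop), ?_⟩
  rw [hasFiniteIntegral_iff_ofReal]
  · exact (hC r hr).trans_lt ENNReal.ofReal_lt_top
  · exact Filter.Eventually.of_forall fun z =>
      div_nonneg (besselKernel_nonneg α z) (norm_nonneg z)

lemma smallBallCond_besselKernel {α : ℝ} (hα : 1 < α) (T : ℝ) {ν : ℝ} (h0 : 0 < ν)
    (h1 : ν < min (α - 1) 1) : SmallBallCond (besselKernel α) T ν := by
  obtain ⟨hν, hν1⟩ := lt_min_iff.1 h1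
  obtain ⟨C, hC⟩ := exists_lintegral_closedBall_besselKernel_le h0.le hν (by linarith)
  -- Since `ENNReal.ofReal` truncates negative numbers, returning to a real inequality requires a
  -- nonnegative right-hand side.
  refine ⟨max C 0, fun r hr _ => ⟨integrableOn_besselKernel_div_norm hα hr, ?_⟩⟩
  have hint := integrableOn_besselKernel_div_norm hα hr
  have := hC r hr
  rw [← ofReal_integral_eq_lintegral_ofReal hint (Filter.Eventually.of_forall fun z =>
      div_nonneg (besselKernel_nonneg α z) (norm_nonneg z))] at this
  rw [← ENNReal.ofReal_le_ofReal_iff (by positivity)]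
  refine this.trans (ENNReal.ofReal_le_ofReal ?_)
  gcongr
  exact le_max_left _ _


/-! ### Time increments -/

lemma inner_add_right_S2 (ξ η : S2) :
    inner ℝ ((ξ : R3) + (η : R3)) (η : R3) = ‖(ξ : R3) + (η : R3)‖ ^ 2 / 2 := by
  rw [norm_add_sq_real, inner_add_left, real_inner_self_eq_norm_sq, norm_S2, norm_S2]
  ring

lemma norm_add_S2_sq_le (ξ η : S2) : ‖(ξ : R3) + (η : R3)‖ ^ 2 ≤ 4 := by
  have h := norm_add_le (ξ : R3) (η : R3)
  rw [norm_S2, norm_S2] at h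
  nlinarith [norm_nonneg ((ξ : R3) + (η : R3))]

/-- As ⟨ξ+η, η⟩ = |ξ+η|²/2, the norm depends only on N = |ξ+η|². By symmetry hξ and hη give the same
value, so the four-point time increment collapses to a - 2b + d. -/
lemma norm_smul_add_smul_sq (s h : ℝ) (ξ η : S2) :
    ‖s • ((ξ : R3) + (η : R3)) + h • (η : R3)‖ ^ 2 =
      s ^ 2 * ‖(ξ : R3) + (η : R3)‖ ^ 2 + s * h * ‖(ξ : R3) + (η : R3)‖ ^ 2 + h ^ 2 := by
  rw [norm_add_sq_real, norm_smul, norm_smul, inner_smul_left, inner_smul_right,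
    inner_add_right_S2, norm_S2, mul_pow, mul_pow, Real.norm_eq_abs, Real.norm_eq_abs, sq_abs,
    sq_abs]
  simp
  ring

lemma norm_smul_add_smul_sq' (s h : ℝ) (ξ η : S2) :
    ‖s • ((ξ : R3) + (η : R3)) + h • (ξ : R3)‖ ^ 2 =
      s ^ 2 * ‖(ξ : R3) + (η : R3)‖ ^ 2 + s * h * ‖(ξ : R3) + (η : R3)‖ ^ 2 + h ^ 2 := by
  rw [add_comm (ξ : R3), norm_smul_add_smul_sq]

lemma norm_smul_add_smul_self_sq (s h : ℝ) (v : R3) :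
    ‖s • v + h • v‖ ^ 2 = (s + h) ^ 2 * ‖v‖ ^ 2 := by
  rw [← add_smul, norm_smul, mul_pow, Real.norm_eq_abs, sq_abs]

lemma norm_smul_sq (s : ℝ) (v : R3) : ‖s • v‖ ^ 2 = s ^ 2 * ‖v‖ ^ 2 := by
  rw [norm_smul, mul_pow, Real.norm_eq_abs, sq_abs]

lemma exp_neg_le_of_one_le {κ ρ D a : ℝ} (hκ : 1 ≤ κ) (hρ : 0 ≤ ρ) (hD : 0 ≤ D) (ha : D ≤ a) :
    Real.exp (-a) ≤ κ ^ (ρ / 2) * Real.exp (-(D / 4)) := by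
  have h1 : 1 ≤ κ ^ (ρ / 2) := Real.one_le_rpow hκ (by linarith)
  have h2 : Real.exp (-a) ≤ Real.exp (-(D / 4)) := Real.exp_le_exp.2 (by linarith)
  nlinarith [Real.exp_pos (-(D / 4))]

/-- With D = s²N/(4t) and κ = h²/t, both exponents are at least D, and the cross term q = shN/(4t)
satisfies q² ≤ κD precisely because N ≤ 4. -/
lemma exp_time_increment_le {s h t N ρ : ℝ} (hs : 0 < s) (hh : 0 < h) (ht : 0 < t) (hN0 : 0 ≤ N)
    (hN4 : N ≤ 4) (hρ : 0 ≤ ρ) (hρ1 : ρ ≤ 1) :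
    |Real.exp (-((s + h) ^ 2 * N / (4 * t))) -
        Real.exp (-((s ^ 2 * N + s * h * N + h ^ 2) / (4 * t)))| ≤
      12 * (h ^ 2 / t) ^ (ρ / 2) * Real.exp (-(s ^ 2 / (16 * t) * N)) := by
  set D := s ^ 2 * N / (4 * t) with hD
  have hD0 : 0 ≤ D := by positivity
  have hDe : s ^ 2 / (16 * t) * N = D / 4 := by rw [hD]; field_simp; ring
  have hshN : 0 ≤ s * h * N := by positivity
  have ha : D ≤ (s + h) ^ 2 * N / (4 * t) := by rw [hD]; gcongr; linarith
  have hb : D ≤ (s ^ 2 * N + s * h * N + h ^ 2) / (4 * t) := by rw [hD]; gcongr; nlinarith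
  rw [hDe]
  rcases le_or_gt (h ^ 2 / t) 1 with hk | hk
  · refine exp_increment_le (p := s * h * N / (4 * t)) hD0 (by positivity) hk ?_ (by linarith)
      (by linarith) ?_ hρ1
    · have e : h ^ 2 / t * D - (s * h * N / (4 * t)) ^ 2 =
          s ^ 2 * h ^ 2 * N * (4 - N) / (16 * t ^ 2) := by rw [hD]; field_simp; ring
      have : 0 ≤ s ^ 2 * h ^ 2 * N * (4 - N) / (16 * t ^ 2) := by
        have : 0 ≤ 4 - N := by linarith
        positivity
      linarith
    · have e : (s + h) ^ 2 * N / (4 * t) - (s ^ 2 * N + s * h * N + h ^ 2) / (4 * t) =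
          s * h * N / (4 * t) + h ^ 2 / t * ((N - 1) / 4) := by field_simp; ring
      rw [e]
      refine (abs_add_le _ _).trans ?_
      have hp : 0 ≤ h ^ 2 / t := by positivity
      rw [abs_of_nonneg (by positivity), abs_mul, abs_of_nonneg hp]
      have : |(N - 1) / 4| ≤ 1 := by rw [abs_le]; constructor <;> linarith
      nlinarith
  · have h1 := exp_neg_le_of_one_le hk.le hρ hD0 ha
    have h2 := exp_neg_le_of_one_le hk.le hρ hD0 hb
    have p1 := Real.exp_pos (-((s + h) ^ 2 * N / (4 * t)))
    have p2 := Real.exp_pos (-((s ^ 2 * N + s * h * N + h ^ 2) / (4 * t)))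
    rw [abs_le]
    constructor <;> linarith

lemma exp_time_second_increment_le {s h t N ρ : ℝ} (hs : 0 < s) (hh : 0 < h) (ht : 0 < t)
    (hN0 : 0 ≤ N) (hN4 : N ≤ 4) (hρ : 0 ≤ ρ) (hρ2 : ρ ≤ 2) :
    |Real.exp (-((s + h) ^ 2 * N / (4 * t))) -
        2 * Real.exp (-((s ^ 2 * N + s * h * N + h ^ 2) / (4 * t))) +
          Real.exp (-(s ^ 2 * N / (4 * t)))| ≤
      12 * (h ^ 2 / t) ^ (ρ / 2) * Real.exp (-(s ^ 2 / (16 * t) * N)) := by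
  set D := s ^ 2 * N / (4 * t) with hD
  have hD0 : 0 ≤ D := by positivity
  have hDe : s ^ 2 / (16 * t) * N = D / 4 := by rw [hD]; field_simp; ring
  have hshN : 0 ≤ s * h * N := by positivity
  have ha : D ≤ (s + h) ^ 2 * N / (4 * t) := by rw [hD]; gcongr; linarith
  have hb : D ≤ (s ^ 2 * N + s * h * N + h ^ 2) / (4 * t) := by rw [hD]; gcongr; nlinarith
  rw [hDe]
  rcases le_or_gt (h ^ 2 / t) 1 with hk | hk
  · refine exp_second_increment_le (by positivity) hk (by linarith) (by linarith) (by linarith)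
      ?_ hρ2
    have hp : 0 ≤ h ^ 2 / t := by positivity
    set κ := h ^ 2 / t with hκ
    set q := s * h * N / (4 * t) with hq
    have hq2 : q ^ 2 ≤ κ * D := by
      have e : κ * D - q ^ 2 =
          s ^ 2 * h ^ 2 * N * (4 - N) / (16 * t ^ 2) := by rw [hκ, hq, hD]; field_simp; ring
      have : 0 ≤ s ^ 2 * h ^ 2 * N * (4 - N) / (16 * t ^ 2) := by
        have : 0 ≤ 4 - N := by linarith
        positivity
      linarith
    have e1 : (s + h) ^ 2 * N / (4 * t) - D = 2 * q + κ * (N / 4) := by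
      rw [hκ, hq, hD]; field_simp; ring
    have e2 : (s + h) ^ 2 * N / (4 * t) + D - 2 * ((s ^ 2 * N + s * h * N + h ^ 2) / (4 * t)) =
        κ * ((N - 2) / 4) := by rw [hκ, hD]; field_simp; ring
    rw [e1, e2, abs_mul, abs_of_nonneg hp]
    have h1 : |(N - 2) / 4| ≤ 1 / 2 := by rw [abs_le]; constructor <;> linarith
    have h2 : (κ * (N / 4)) ^ 2 ≤ κ := by
      have : 0 ≤ κ * (N / 4) := by positivity
      have : κ * (N / 4) ≤ κ := by nlinarith
      nlinarith
    have h3 : κ * |(N - 2) / 4| ≤ κ * (1 / 2) := by gcongr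
    -- By (x+y)² ≤ 2x² + 2y², the squared part is at most 2q² + κ/2 ≤ 2κD + κ/2; the remaining term
    -- adds κ/2.
    nlinarith [sq_nonneg (2 * q - κ * (N / 4))]
  · have h1 := exp_neg_le_of_one_le hk.le hρ hD0 ha
    have h2 := exp_neg_le_of_one_le hk.le hρ hD0 hb
    have h3 := exp_neg_le_of_one_le hk.le hρ hD0 le_rfl
    have p1 := Real.exp_pos (-((s + h) ^ 2 * N / (4 * t)))
    have p2 := Real.exp_pos (-((s ^ 2 * N + s * h * N + h ^ 2) / (4 * t)))
    have p3 := Real.exp_pos (-D)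
    rw [abs_le]
    constructor <;> linarith

/-- Integration of a Gaussian-mixture bound in `ξ + η` over both spheres and over time. -/
lemma exists_lintegral_time_le {α T ρ θ : ℝ} (j : ℕ) (hT : 0 < T) (hθ0 : 0 ≤ θ) (hθ1 : θ ≤ 1)
    (hj : -1 < (j : ℝ) - 2 * θ) (hp : -1 < (α - 5) / 2 + (θ - ρ / 2))
    (Φ : ℝ → ℝ → S2 → S2 → ℝ)
    (hΦ : ∀ h s : ℝ, 0 < h → 0 < s → ∀ η ξ : S2, ξ ≠ -η → ENNReal.ofReal |Φ h s η ξ| ≤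
      ∫⁻ t in Ioi (0 : ℝ), ENNReal.ofReal (besselWeight α t * (12 * (h ^ 2 / t) ^ (ρ / 2) *
        Real.exp (-(s ^ 2 / (16 * t) * ‖(ξ : R3) + (η : R3)‖ ^ 2))))) :
    ∃ C : ℝ, ∀ h : ℝ, 0 < h → h ≤ 1 →
      ∫⁻ s in Ioc (0 : ℝ) T, ∫⁻ η : S2, ∫⁻ ξ : S2,
        ENNReal.ofReal (|Φ h s η ξ| * s ^ j) ∂sigma ∂sigma ≤ ENNReal.ofReal (C * h ^ ρ) := by
  obtain ⟨C, hC, hS⟩ := exists_lintegral_sphere_exp_le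
  set M := sigma.real univ
  have hM : 0 ≤ M := measureReal_nonneg
  set B := 12 * C * (16 : ℝ) ^ θ * besselMoment α (θ - ρ / 2) * M
  have hB : 0 ≤ B := by
    have := besselMoment_nonneg α (θ - ρ / 2)
    positivity
  refine ⟨B * ∫ s in Ioc (0 : ℝ) T, s ^ ((j : ℝ) - 2 * θ), fun h hh _ => ?_⟩
  -- This bound is uniform in η, so the η-integral only contributes the mass M. The sphere estimate
  -- at c = s²/(16t) converts s² into s^{-2θ} and leaves t^{θ-ρ/2} for the moment.
  have hξ : ∀ s ∈ Ioc (0 : ℝ) T, ∀ η : S2,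
      ∫⁻ ξ : S2, ENNReal.ofReal (|Φ h s η ξ| * s ^ j) ∂sigma ≤ ENNReal.ofReal
        (12 * h ^ ρ * C * (s ^ 2 / 16) ^ (-θ) * s ^ j * besselMoment α (θ - ρ / 2)) := by
    intro s hs η
    have hs0 : 0 < s := hs.1
    refine lintegral_le_besselMoment
      (G := fun t (ξ : S2) => 12 * (h ^ 2 / t) ^ (ρ / 2) *
        Real.exp (-(s ^ 2 / (16 * t) * ‖(ξ : R3) + (η : R3)‖ ^ 2)) * s ^ j)
      (by simp only [Function.uncurry_def]; fun_prop) hp (by positivity) ?_ ?_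
    · have hae : ∀ᵐ ξ ∂sigma, ξ ∉ ({-η} : Set S2) :=
        measure_eq_zero_iff_ae_notMem.1 (sigma_singleton _)
      filter_upwards [hae] with ξ hξ
      simp only [← mul_assoc, ENNReal.ofReal_mul' (show 0 ≤ s ^ j by positivity)]
      rw [lintegral_mul_const' _ _ ENNReal.ofReal_ne_top]
      gcongr
      simpa only [mul_assoc] using hΦ h s hh hs0 η ξ hξ
    · intro t ht
      have hk : 0 ≤ 12 * (h ^ 2 / t) ^ (ρ / 2) * s ^ j := by positivity
      calc _ = ENNReal.ofReal (12 * (h ^ 2 / t) ^ (ρ / 2) * s ^ j) * ∫⁻ ξ : S2, ENNReal.ofReal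
              (Real.exp (-(s ^ 2 / (16 * t) * ‖(ξ : R3) + (η : R3)‖ ^ 2))) ∂sigma := by
            rw [← lintegral_const_mul' _ _ ENNReal.ofReal_ne_top]
            refine lintegral_congr fun ξ => ?_
            rw [← ENNReal.ofReal_mul hk]
            congr 1; ring
        _ ≤ ENNReal.ofReal (12 * (h ^ 2 / t) ^ (ρ / 2) * s ^ j) *
              ENNReal.ofReal (C * (s ^ 2 / (16 * t)) ^ (-θ)) := by
            gcongr
            exact hS θ hθ0 hθ1 _ (by positivity) η
        _ = _ := by
            rw [← ENNReal.ofReal_mul hk]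
            congr 1
            have e1 : (s ^ 2 / (16 * t)) ^ (-θ) = (s ^ 2 / 16) ^ (-θ) * t ^ θ := by
              rw [← div_div, Real.div_rpow (by positivity) ht.le, Real.rpow_neg ht.le, div_inv_eq_mul]
            have e2 : (h ^ 2 / t) ^ (ρ / 2) = h ^ ρ / t ^ (ρ / 2) := by
              rw [Real.div_rpow (by positivity) ht.le, ← Real.rpow_natCast, ← Real.rpow_mul hh.le]
              congr 2; push_cast; ring
            rw [e1, e2, Real.rpow_sub ht]
            ring
  have hpow : ∀ s : ℝ, 0 < s → (s ^ 2 / 16) ^ (-θ) * s ^ j = (16 : ℝ) ^ θ * s ^ ((j : ℝ) - 2 * θ) := by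
    intro s hs
    rw [Real.div_rpow (by positivity) (by norm_num), Real.rpow_neg (by norm_num : (0 : ℝ) ≤ 16),
      div_inv_eq_mul, ← Real.rpow_natCast s 2, ← Real.rpow_mul hs.le, sub_eq_add_neg,
      Real.rpow_add hs, Real.rpow_natCast]
    rw [show ((2 : ℕ) : ℝ) * -θ = -(2 * θ) by push_cast; ring]
    ring
  have hint : IntegrableOn (fun s : ℝ => s ^ ((j : ℝ) - 2 * θ)) (Ioc 0 T) :=
    (intervalIntegrable_iff_integrableOn_Ioc_of_le hT.le).1
      (intervalIntegral.intervalIntegrable_rpow' hj)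
  calc _ ≤ ∫⁻ s in Ioc (0 : ℝ) T, ENNReal.ofReal (B * h ^ ρ * s ^ ((j : ℝ) - 2 * θ)) := by
        refine setLIntegral_mono' measurableSet_Ioc fun s hs => ?_
        refine (lintegral_mono (hξ s hs)).trans (le_of_eq ?_)
        rw [lintegral_const, ← ofReal_measureReal, ← ENNReal.ofReal_mul' hM]
        congr 1
        have := hpow s hs.1
        calc _ = 12 * h ^ ρ * C * ((s ^ 2 / 16) ^ (-θ) * s ^ j) *
              besselMoment α (θ - ρ / 2) * M := by ring
          _ = _ := by rw [this]; simp only [B]; ring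
    _ = _ := by
        rw [← ofReal_integral_eq_lintegral_ofReal (hint.const_mul _)]
        · rw [integral_const_mul]
          congr 1; ring
        · refine (ae_restrict_iff' measurableSet_Ioc).2 (Filter.Eventually.of_forall fun s hs => ?_)
          have : 0 < s := hs.1
          positivity

lemma ofReal_le_lintegral_of_le {α r : ℝ} {u v : ℝ → ℝ}
    (h : ENNReal.ofReal |r| ≤ ∫⁻ t in Ioi (0 : ℝ), ENNReal.ofReal (besselWeight α t * |u t|))
    (huv : ∀ t : ℝ, 0 < t → |u t| ≤ v t) :
    ENNReal.ofReal |r| ≤ ∫⁻ t in Ioi (0 : ℝ), ENNReal.ofReal (besselWeight α t * v t) := by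
  refine h.trans (setLIntegral_mono' measurableSet_Ioi fun t ht => ENNReal.ofReal_le_ofReal ?_)
  exact mul_le_mul_of_nonneg_left (huv t ht) (besselWeight_nonneg α ht)

lemma smul_add_smul_ne_zero {s h : ℝ} (hs : 0 < s) (hh : 0 < h) (ξ η : S2) :
    s • ((ξ : R3) + (η : R3)) + h • (η : R3) ≠ 0 := by
  intro h0
  have := norm_smul_add_smul_sq s h ξ η
  rw [h0, norm_zero] at this
  have h1 : 0 < s ^ 2 * ‖(ξ : R3) + (η : R3)‖ ^ 2 + s * h * ‖(ξ : R3) + (η : R3)‖ ^ 2 + h ^ 2 := by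
    positivity
  norm_num at this
  linarith

lemma add_S2_ne_zero {ξ η : S2} (h : ξ ≠ -η) : (ξ : R3) + (η : R3) ≠ 0 := by
  intro h0
  apply h
  ext1
  exact eq_neg_of_add_eq_zero_left h0

lemma smul_add_smul_self_ne_zero {s h : ℝ} (hs : 0 < s) (hh : 0 < h) {v : R3} (hv : v ≠ 0) :
    s • v + h • v ≠ 0 := by
  rw [← add_smul]
  exact smul_ne_zero (by linarith) hv

lemma timeCond1_besselKernel {α T ρ : ℝ} (hT : 0 < T) (h0 : 0 < ρ) (h1 : ρ < min (α - 1) 1) :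
    TimeCond1 (besselKernel α) T ρ := by
  obtain ⟨hα, hρ1⟩ := lt_min_iff.1 h1
  -- With a single factor s, θ = 1 would leave the non-integrable s^{-1}. Taking θ = 1-ε gives
  -- s^{-1+2ε}, and the moment condition becomes ρ < α-1-2ε, which ε ≤ (α-1-ρ)/4 ensures.
  set ε := min (1 / 2) ((α - 1 - ρ) / 4) with hε
  have hε0 : 0 < ε := lt_min (by norm_num) (by linarith)
  have hε1 : ε ≤ 1 / 2 := min_le_left _ _
  have hε2 : ε ≤ (α - 1 - ρ) / 4 := min_le_right _ _
  have := exists_lintegral_time_le (α := α) (T := T) (ρ := ρ) (θ := 1 - ε) 1 hT (by linarith)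
    (by linarith) (by push_cast; linarith) (by linarith)
    (fun h s η ξ => besselKernel α (s • ((ξ : R3) + (η : R3)) + h • ((ξ : R3) + (η : R3)))
            - besselKernel α (s • ((ξ : R3) + (η : R3)) + h • (η : R3))) ?_
  · simpa only [TimeCond1, pow_one] using this
  · intro h s hh hs η ξ hξ
    refine ofReal_le_lintegral_of_le (ofReal_abs_besselKernel_sub_le α
      (smul_add_smul_self_ne_zero hs hh (add_S2_ne_zero hξ)) (smul_add_smul_ne_zero hs hh ξ η)) ?_
    intro t ht
    simp only [gauss, norm_smul_add_smul_sq, norm_smul_add_smul_self_sq]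
    exact exp_time_increment_le hs hh ht (by positivity) (norm_add_S2_sq_le ξ η) h0.le hρ1.le

lemma timeCond2_besselKernel {α T ρ : ℝ} (hT : 0 < T) (h0 : 0 < ρ) (h1 : ρ < min (α - 1) 2) :
    TimeCond2 (besselKernel α) T ρ := by
  obtain ⟨hα, hρ2⟩ := lt_min_iff.1 h1
  -- The factor s² cancels s^{-2θ} at the endpoint θ = 1, so the full range ρ < α-1 needs no loss.
  refine exists_lintegral_time_le (α := α) (T := T) (ρ := ρ) (θ := 1) 2 hT (by linarith)
    (by linarith) (by norm_num) (by linarith)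
    (fun h s η ξ => besselKernel α (s • ((ξ : R3) + (η : R3)) + h • ((ξ : R3) + (η : R3)))
            - besselKernel α (s • ((ξ : R3) + (η : R3)) + h • (ξ : R3))
            - besselKernel α (s • ((ξ : R3) + (η : R3)) + h • (η : R3))
            + besselKernel α (s • ((ξ : R3) + (η : R3)))) ?_
  intro h s hh hs η ξ hξ
  have hv := add_S2_ne_zero hξ
  refine ofReal_le_lintegral_of_le (ofReal_abs_besselKernel_second_le α
    (smul_add_smul_self_ne_zero hs hh hv)
    (by rw [add_comm (ξ : R3)]; exact smul_add_smul_ne_zero hs hh η ξ)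
    (smul_add_smul_ne_zero hs hh ξ η) (smul_ne_zero hs.ne' hv)) ?_
  intro t ht
  simp only [gauss, norm_smul_add_smul_sq, norm_smul_add_smul_sq', norm_smul_add_smul_self_sq,
    norm_smul_sq]
  rw [show ∀ a b c : ℝ, a - b - b + c = a - 2 * b + c by intros; ring]
  exact exp_time_second_increment_le hs hh ht (by positivity) (norm_add_S2_sq_le ξ η) h0.le hρ2.le


end StochWave

end

theorem proposition5p3 (α : ℝ) (hα : 1 < α) (T : ℝ) (hT : 0 < T) :
    (∀ x : StochWave.R3, x ≠ 0 →
      MeasureTheory.IntegrableOn (StochWave.besselIntegrand α x) (Set.Ioi 0)) ∧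
    StochWave.CondH1 (StochWave.besselKernel α) ∧
    (∀ γ : ℝ, 0 < γ → γ < min (α - 1) 1 →
      StochWave.SpaceCond1 (StochWave.besselKernel α) T γ) ∧
    (∀ γ' : ℝ, 0 < γ' → γ' < min (α - 1) 2 →
      StochWave.SpaceCond2 (StochWave.besselKernel α) T γ') ∧
    (∀ ν : ℝ, 0 < ν → ν < min (α - 1) 1 →
      StochWave.SmallBallCond (StochWave.besselKernel α) T ν) ∧
    (∀ ρ₁ : ℝ, 0 < ρ₁ → ρ₁ < min (α - 1) 1 →
      StochWave.TimeCond1 (StochWave.besselKernel α) T ρ₁) ∧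
    (∀ ρ₂ : ℝ, 0 < ρ₂ → ρ₂ < min (α - 1) 2 →
      StochWave.TimeCond2 (StochWave.besselKernel α) T ρ₂) :=
  ⟨fun _ hx => StochWave.integrableOn_besselIntegrand α hx,
    StochWave.integrableOn_besselKernel_div_norm hα one_pos,
    fun _ h0 h1 => StochWave.spaceCond1_besselKernel T h0 h1,
    fun _ h0 h1 => StochWave.spaceCond2_besselKernel T h0 h1,
    fun _ h0 h1 => StochWave.smallBallCond_besselKernel hα T h0 h1,
    fun _ h0 h1 => StochWave.timeCond1_besselKernel hT h0 h1,
    fun _ h0 h1 => StochWave.timeCond2_besselKernel hT h0 h1⟩
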